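/- **Lemma 3.10.** *Setting.* Let $M$ be a smooth ($C^\infty$) riemannian manifold without boundary, all of whose connected components have dimension $d$; $M$ need be neither connected nor complete. *Compact smooth polyhedra.* A connected compact smooth polyhedron of dimension $0$ in $M$ is a point; it has no proper faces, its boundary is empty and it is its own interior. For $k\ge1$, a connected compact smooth polyhedron of dimension $k$ is a connected compact subset $F\subset M$, contained in some connected embedded smooth $k$-dimensional submanifold $S\subset M$, such that the interior $\mathring F$ of $F$ relative to $S$ is nonempty and $F=\operatorname{Cl}\mathring F$, together with a (possibly empty) finite family of connected compact smooth polyhedra $s_1,\dots,s_n$ of dimension $k-1$ (the codimension $1$ faces of $F$) such that $\partial F:=F\setminus\mathring F=\bigcup_j s_j$ and, for all $i\neq j$, $s_i\cap s_j=\partial s_i\cap\partial s_j$ and this intersection is a (possibly empty) union of entire faces; here the only codimension $0$ face of $F$ is $F$ itself, and the codimension $l+1$ faces of $F$ are the codimension $l$ faces of $s_1,\dots,s_n$. A compact smooth polyhedron $P$ of dimension $k$ is a finite disjoint union of connected ones; its faces of positive codimension are those of its connected members, and its interior is the union of their interiors. *Face-pairing.* Let $P\subset M$ be a compact smooth polyhedron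 of dimension $d$ and let $\mathcal S$ be the set of its codimension $1$ faces. A face-pairing of $P$ consists of an involution $s\mapsto\overline s$ of $\mathcal S$ and, for each $s\in\mathcal S$, a riemannian isometry $I_s$ of the connected component of $M$ containing $s$ onto a connected component of $M$, such that $I_s s=\overline s$, $I_{\overline s}=I_s^{-1}$, $I_s$ maps every face of $s$ onto a face of $\overline s$, and every codimension $2$ face of $P$ is a codimension $1$ face of exactly two members of $\mathcal S$. We write $I_{\overline s}P$ for the image under $I_{\overline s}$ of the part of $P$ lying in the domain of $I_{\overline s}$. *Two conditions.* For $s\in\mathcal S$ and $x\in\mathring s$, let $n_s(x)\in T_xM$ be the unit vector normal to $s$ at $x$ that points toward the interior of $P$. The face-pairing isometries send *interior into exterior* if $dI_s\big(n_s(x)\big)=-n_{\overline s}(I_sx)$ for all $s\in\mathcal S$ and all $x\in\mathring s$. The polyhedra $P$ and $I_{\overline s}P$, which share the face $s$, *tessellate* a neighbourhood $B$ of $x\in\mathring s$ if $B=B_1\cup B_2$ and $B_1\cap B_2=B\cap s$, where $B_1:=B\cap P$ and $B_2:=B\cap I_{\overline s}P$. *Statement.* Let $P\subset M$ be a compact smooth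 polyhedron of dimension $d$ with a face-pairing. Then the face-pairing isometries of $P$ send interior into exterior if and only if, for every codimension $1$ face $s$ of $P$ and every $x\in\mathring s$, the polyhedra $P$ and $I_{\overline s}P$ tessellate some neighbourhood of $x$. -/

import Mathlib

open scoped Manifold ContDiff Topology Bundle

namespace SmoothPoly

universe u

/-- `S` is a smooth (embedded) submanifold of dimension `k` of the `m`-dimensional smooth
manifold `M`: around each of its points there is a smooth chart of `M` in which `S` becomes a
piece of a `k`-dimensional affine subspace. -/
def IsSubmanifold (m : ℕ) {M : Type u} [TopologicalSpace M]
    [ChartedSpace (EuclideanSpace ℝ (Fin m)) M] (k : ℕ) (S : Set M) : Prop :=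
  ∀ p ∈ S, ∃ φ ∈ IsManifold.maximalAtlas (𝓡 m) ∞ M, p ∈ φ.source ∧
    ∃ W : Submodule ℝ (EuclideanSpace ℝ (Fin m)), Module.finrank ℝ W = k ∧
      ∀ q ∈ φ.source, q ∈ S ↔ φ q - φ p ∈ W

/-- The interior of `F`, where `F` is considered as a subset of the subspace `S`. -/
def relInterior {M : Type u} [TopologicalSpace M] (S F : Set M) : Set M :=
  {x | x ∈ S ∧ F ∈ 𝓝[S] x}

/-- The combinatorial data of a connected polyhedron in `M`: the underlying subset together with
the finite list of its codimension `1` faces, which are data of the same kind. -/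
inductive Cell (M : Type u) : Type u
  | mk (carrier : Set M) (numFacets : ℕ) (facet : Fin numFacets → Cell M) : Cell M

namespace Cell

variable {M : Type u}

/-- The underlying subset. -/
def carrier : Cell M → Set M
  | mk F _ _ => F

/-- The number of codimension `1` faces. -/
def numFacets : Cell M → ℕ
  | mk _ n _ => n

/-- The codimension `1` faces. -/
def facet : (c : Cell M) → Fin c.numFacets → Cell M
  | mk _ _ s => s

/-- The boundary: the union of the codimension `1` faces. -/
def boundary (c : Cell M) : Set M := ⋃ j, (c.facet j).carrier

/-- The interior: the complement of the boundary. For a connected compact smooth polyhedron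
(`IsConnectedPolyhedron` below) this is the interior relative to a submanifold of the face. -/
def interior (c : Cell M) : Set M := c.carrier \ c.boundary

/-- The (underlying sets of the) faces of codimension `k`. -/
def faces : ℕ → Cell M → Set (Set M)
  | 0, c => {c.carrier}
  | k + 1, c => ⋃ j, faces k (c.facet j)

end Cell

/-- Connected compact smooth polyhedra of dimension `k` in the `m`-dimensional manifold `M`. -/
def IsConnectedPolyhedron (m : ℕ) {M : Type u} [TopologicalSpace M]
    [ChartedSpace (EuclideanSpace ℝ (Fin m)) M] : ℕ → Cell M → Prop
  | 0, c => (∃ p, c.carrier = {p}) ∧ c.numFacets = 0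
  | k + 1, c =>
    IsCompact c.carrier ∧ IsConnected c.carrier ∧
    (∃ S : Set M, IsSubmanifold m (k + 1) S ∧ IsConnected S ∧ c.carrier ⊆ S ∧
      (relInterior S c.carrier).Nonempty ∧
      c.carrier = closure (relInterior S c.carrier) ∧
      c.carrier \ relInterior S c.carrier = c.boundary) ∧
    (∀ j, IsConnectedPolyhedron m k (c.facet j)) ∧
    ∀ i j, i ≠ j →
      (c.facet i).carrier ∩ (c.facet j).carrier = (c.facet i).boundary ∩ (c.facet j).boundary ∧
      ∃ T : Set (Set M), (∀ f ∈ T, ∃ l n, f ∈ (c.facet l).faces n) ∧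
        (c.facet i).carrier ∩ (c.facet j).carrier = ⋃₀ T

/-- Compact smooth polyhedra of dimension `k` in the `m`-dimensional manifold `M`: finite disjoint
unions of connected ones, the codimension `0` faces. -/
structure CompactSmoothPolyhedron (m k : ℕ) (M : Type u) [TopologicalSpace M]
    [ChartedSpace (EuclideanSpace ℝ (Fin m)) M] where
  numCells : ℕ
  cell : Fin numCells → Cell M
  isConnectedPolyhedron : ∀ i, IsConnectedPolyhedron m k (cell i)
  disjoint : ∀ i j, i ≠ j → Disjoint (cell i).carrier (cell j).carrier

namespace CompactSmoothPolyhedron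

variable {m k : ℕ} {M : Type u} [TopologicalSpace M] [ChartedSpace (EuclideanSpace ℝ (Fin m)) M]

/-- The underlying subset. -/
def carrier (P : CompactSmoothPolyhedron m k M) : Set M := ⋃ i, (P.cell i).carrier

/-- The interior, the union of the interiors of the codimension `0` faces. -/
def interior (P : CompactSmoothPolyhedron m k M) : Set M := ⋃ i, (P.cell i).interior

/-- The finite set of all codimension `1` faces (distinct indices give distinct subsets). -/
abbrev Facet (P : CompactSmoothPolyhedron m k M) : Type := Σ i, Fin (P.cell i).numFacets

/-- The codimension `1` face with a given index. -/
def facet (P : CompactSmoothPolyhedron m k M) (s : P.Facet) : Cell M := (P.cell s.1).facet s.2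

end CompactSmoothPolyhedron

section Riemannian

variable {m : ℕ} {M : Type u} [TopologicalSpace M] [ChartedSpace (EuclideanSpace ℝ (Fin m)) M]

/-- A morphism of the isometry groupoid of the riemannian manifold `M`: a riemannian isometry of
a connected component of `M` onto a connected component of `M`. -/
structure ComponentIsometry (m : ℕ) (M : Type u) [TopologicalSpace M]
    [ChartedSpace (EuclideanSpace ℝ (Fin m)) M] [IsManifold (𝓡 m) ∞ M]
    [Bundle.RiemannianBundle (fun x : M ↦ TangentSpace (𝓡 m) x)] where
  toHomeo : OpenPartialHomeomorph M M
  source_eq : ∃ x, toHomeo.source = connectedComponent x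
  target_eq : ∃ y, toHomeo.target = connectedComponent y
  contMDiffOn : ContMDiffOn (𝓡 m) (𝓡 m) ∞ toHomeo toHomeo.source
  contMDiffOn_symm : ContMDiffOn (𝓡 m) (𝓡 m) ∞ toHomeo.symm toHomeo.target
  inner_mfderiv : ∀ x ∈ toHomeo.source, ∀ v w : TangentSpace (𝓡 m) x,
    inner ℝ (mfderiv (𝓡 m) (𝓡 m) toHomeo x v) (mfderiv (𝓡 m) (𝓡 m) toHomeo x w) = inner ℝ v w

/-- The image of a subset of `M` under a morphism of the isometry groupoid, which is applied to the
points of the subset where it is defined. -/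
def ComponentIsometry.image [IsManifold (𝓡 m) ∞ M]
    [Bundle.RiemannianBundle (fun x : M ↦ TangentSpace (𝓡 m) x)]
    (g : ComponentIsometry m M) (A : Set M) : Set M :=
  g.toHomeo '' (A ∩ g.toHomeo.source)

/-- `γ` is a smooth curve (germ at `0`) through `x` with velocity `v` at `x`. -/
def IsCurveWithVelocity (γ : ℝ → M) (x : M) (v : TangentSpace (𝓡 m) x) : Prop :=
  γ 0 = x ∧ ContMDiffAt 𝓘(ℝ, ℝ) (𝓡 m) ∞ γ 0 ∧
    HasMFDerivAt 𝓘(ℝ, ℝ) (𝓡 m) γ 0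
      (ContinuousLinearMap.toSpanSingleton ℝ (v : EuclideanSpace ℝ (Fin m)))

/-- `v` is tangent to the subset `A` at `x`: it is the velocity of a smooth curve lying in `A`. At
the points where `A` is locally a submanifold this describes the tangent space of `A`. -/
def IsTangentTo (A : Set M) (x : M) (v : TangentSpace (𝓡 m) x) : Prop :=
  ∃ γ : ℝ → M, IsCurveWithVelocity γ x v ∧ ∀ᶠ t in 𝓝 0, γ t ∈ A

/-- `v` points toward the subset `A` at `x`: it is the velocity of a smooth curve that starts at
`x` and immediately enters `A`. -/
def PointsToward (A : Set M) (x : M) (v : TangentSpace (𝓡 m) x) : Prop :=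
  ∃ γ : ℝ → M, IsCurveWithVelocity γ x v ∧ ∀ᶠ t in 𝓝[>] 0, γ t ∈ A

/-- `n` is the unit normal vector at `x` (an interior point of the codimension `1` face `s`) to `s`
that points toward the interior of `P`. -/
structure IsInwardNormal [Bundle.RiemannianBundle (fun x : M ↦ TangentSpace (𝓡 m) x)]
    (P : CompactSmoothPolyhedron m m M) (s : P.Facet) (x : M) (n : TangentSpace (𝓡 m) x) :
    Prop where
  norm_eq_one : ‖n‖ = 1
  normal : ∀ v : TangentSpace (𝓡 m) x, IsTangentTo (P.facet s).carrier x v → inner ℝ n v = 0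
  inward : PointsToward P.interior x n

/-- A face-pairing of the `m`-dimensional compact smooth polyhedron `P` in the `m`-dimensional
riemannian manifold `M`. -/
structure FacePairing [IsManifold (𝓡 m) ∞ M]
    [Bundle.RiemannianBundle (fun x : M ↦ TangentSpace (𝓡 m) x)]
    (P : CompactSmoothPolyhedron m m M) where
  /-- the involution `s ↦ s̄` on the set of codimension `1` faces -/
  bar : P.Facet → P.Facet
  bar_bar : ∀ s, bar (bar s) = s
  /-- the isometries `I_s` -/
  iso : P.Facet → ComponentIsometry m M
  carrier_subset : ∀ s, (P.facet s).carrier ⊆ (iso s).toHomeo.source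
  image_carrier : ∀ s, (iso s).image (P.facet s).carrier = (P.facet (bar s)).carrier
  /-- `I_{s̄}` is the inverse of `I_s`, as morphisms between components -/
  iso_bar : ∀ s, (iso (bar s)).toHomeo.EqOnSource (iso s).toHomeo.symm
  /-- every codimension `2` face of `P` belongs to exactly two codimension `1` faces -/
  two_facets : ∀ s, ∀ e ∈ (P.facet s).faces 1,
    {t : P.Facet | e ∈ (P.facet t).faces 1}.ncard = 2
  /-- `I_s` maps any face of `s` onto a face of `s̄` -/
  image_face : ∀ s k, ∀ f ∈ (P.facet s).faces k,
    ∃ l, (iso s).image f ∈ (P.facet (bar s)).faces l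

/-- The face-pairing isometries send interior into exterior: `I_s n_s = - n_{s̄}` for every
codimension `1` face `s`. -/
def FacePairing.InteriorIntoExterior [IsManifold (𝓡 m) ∞ M]
    [Bundle.RiemannianBundle (fun x : M ↦ TangentSpace (𝓡 m) x)]
    {P : CompactSmoothPolyhedron m m M} (Φ : FacePairing P) : Prop :=
  ∀ s, ∀ x ∈ (P.facet s).interior,
    ∃ (n : TangentSpace (𝓡 m) x) (n' : TangentSpace (𝓡 m) ((Φ.iso s).toHomeo x)),
      IsInwardNormal P s x n ∧ IsInwardNormal P (Φ.bar s) ((Φ.iso s).toHomeo x) n' ∧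
      mfderiv (𝓡 m) (𝓡 m) (Φ.iso s).toHomeo x n = -n'

/-- The polyhedra `P₁`, `P₂` with common codimension `1` face `s` tessellate `B`:
with `Bᵢ := B ∩ Pᵢ` one has `B = B₁ ∪ B₂` and `B₁ ∩ B₂ = B ∩ s`. -/
def Tessellate {M : Type u} (P₁ P₂ s B : Set M) : Prop :=
  B = (B ∩ P₁) ∪ (B ∩ P₂) ∧ (B ∩ P₁) ∩ (B ∩ P₂) = B ∩ s

end Riemannian

end SmoothPoly

/-! Both conditions are local at an interior point x of a face s, and both say that one real number
c is negative.

Near x the polyhedron P is `{0 ≤ f}`, its interior is `{0 < f}` and s is `{f = 0}`, where f is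
affine in a suitable chart and df ≠ 0 (`exists_isFlatAt_of_mem_interior_facet`). The topological
input is `IsFlatAt.exists_side`: since x is not interior to P and P is the closure of its interior,
P occupies exactly one side of s. Face-pairings preserve interiors of faces (`iso_mem_interior`), so
P has a defining function f' at the image point too, and g = f' ∘ I_s defines the image of P under
I_s̄ near x. Both f and g vanish exactly on s near x, hence dg = c df at x with c ≠ 0
(`exists_eq_mul`).

Tessellation is equivalent to c < 0 (`exists_tessellate_iff`): if c > 0, a curve with df < 0 leaves
both polyhedra at once; if c < 0, then f and g have opposite signs on either side of s, each side
being connected and g having no zero there.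

Opposite normals are also equivalent to c < 0: an inward unit normal n has df(n) > 0
(`IsInwardNormal.pos`), and df'(dI_s n) = c df(n). When c < 0, the isometry property makes -dI_s n
the inward unit normal at the image point. -/

namespace SmoothPoly

universe u

/-! ### Curves with prescribed velocity -/

section Curves

variable {m : ℕ} {M : Type u} [TopologicalSpace M] [ChartedSpace (EuclideanSpace ℝ (Fin m)) M]

theorem mdifferentiable_of_mem_maximalAtlas [IsManifold (𝓡 m) ∞ M]
    {φ : OpenPartialHomeomorph M (EuclideanSpace ℝ (Fin m))}
    (hφ : φ ∈ IsManifold.maximalAtlas (𝓡 m) ∞ M) : φ.MDifferentiable (𝓡 m) (𝓡 m) :=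
  ⟨(contMDiffOn_of_mem_maximalAtlas hφ).mdifferentiableOn (by simp),
    (contMDiffOn_symm_of_mem_maximalAtlas hφ).mdifferentiableOn (by simp)⟩

theorem IsCurveWithVelocity.tendsto {γ : ℝ → M} {x : M} {v : TangentSpace (𝓡 m) x}
    (h : IsCurveWithVelocity γ x v) : Filter.Tendsto γ (𝓝 0) (𝓝 x) := by
  have := h.2.1.continuousAt
  rwa [ContinuousAt, h.1] at this

/-- The derivative of a function along a curve. -/
theorem IsCurveWithVelocity.hasDerivAt_comp {γ : ℝ → M} {x : M} {v : TangentSpace (𝓡 m) x}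
    (h : IsCurveWithVelocity γ x v) {f : M → ℝ} {D : TangentSpace (𝓡 m) x →L[ℝ] ℝ}
    (hf : HasMFDerivAt (𝓡 m) 𝓘(ℝ, ℝ) f x D) : HasDerivAt (fun t ↦ f (γ t)) (D v) 0 := by
  obtain ⟨h0, -, h2⟩ := h
  subst h0
  have h3 : HasFDerivAt (f ∘ γ)
      (D.comp (ContinuousLinearMap.toSpanSingleton ℝ (v : EuclideanSpace ℝ (Fin m)))) (0 : ℝ) :=
    (hf.comp 0 h2).hasFDerivAt
  have h4 := h3.hasDerivAt
  rw [ContinuousLinearMap.comp_apply, ContinuousLinearMap.toSpanSingleton_apply_one] at h4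
  exact h4

/-- In a chart, every tangent vector is the velocity of a straight line. -/
theorem isCurveWithVelocity_line [IsManifold (𝓡 m) ∞ M]
    {φ : OpenPartialHomeomorph M (EuclideanSpace ℝ (Fin m))}
    (hφ : φ ∈ IsManifold.maximalAtlas (𝓡 m) ∞ M) {x : M} (hx : x ∈ φ.source)
    {v : TangentSpace (𝓡 m) x} {w : EuclideanSpace ℝ (Fin m)}
    (hw : mfderiv (𝓡 m) (𝓡 m) φ x v = w) :
    IsCurveWithVelocity (fun t : ℝ ↦ φ.symm (φ x + t • w)) x v := by
  have hd := mdifferentiable_of_mem_maximalAtlas hφ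
  have hline0 : φ x + (0 : ℝ) • w = φ x := by simp
  refine ⟨by simp [hx], ?_, ?_⟩
  · have h1 : ContMDiffAt 𝓘(ℝ, ℝ) (𝓡 m) ∞ (fun t : ℝ ↦ φ x + t • w) 0 := by
      apply ContDiffAt.contMDiffAt
      fun_prop
    have h2 : ContMDiffAt (𝓡 m) (𝓡 m) ∞ φ.symm (φ x + (0 : ℝ) • w) := by
      rw [hline0]
      exact contMDiffAt_symm_of_mem_maximalAtlas hφ (φ.map_source hx)
    exact h2.comp (0 : ℝ) h1
  · have h1 : HasMFDerivAt 𝓘(ℝ, ℝ) (𝓡 m) (fun t : ℝ ↦ φ x + t • w) 0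
        (ContinuousLinearMap.toSpanSingleton ℝ w) := by
      apply HasFDerivAt.hasMFDerivAt
      have : HasDerivAt (fun t : ℝ ↦ φ x + t • w) w 0 := by
        simpa using ((hasDerivAt_id (0 : ℝ)).smul_const w).const_add (φ x)
      exact this.hasFDerivAt
    have h2 : HasMFDerivAt (𝓡 m) (𝓡 m) φ.symm (φ x + (0 : ℝ) • w)
        (mfderiv (𝓡 m) (𝓡 m) φ.symm (φ x)) := by
      rw [hline0]
      exact (hd.mdifferentiableAt_symm (φ.map_source hx)).hasMFDerivAt
    refine (h2.comp (0 : ℝ) h1).congr_mfderiv ?_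
    have h4 : mfderiv (𝓡 m) (𝓡 m) φ.symm (φ x) w = v := by
      rw [← hw]
      exact congrArg (fun L ↦ L v) (hd.symm_comp_deriv hx)
    ext1
    change mfderiv (𝓡 m) (𝓡 m) φ.symm (φ x) ((1 : ℝ) • w) = (1 : ℝ) • v
    rw [one_smul, one_smul, h4]

theorem exists_isCurveWithVelocity [IsManifold (𝓡 m) ∞ M] (x : M) (v : TangentSpace (𝓡 m) x) :
    ∃ γ : ℝ → M, IsCurveWithVelocity γ x v :=
  ⟨_, isCurveWithVelocity_line (IsManifold.chart_mem_maximalAtlas x) (mem_chart_source _ x) rfl⟩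

end Curves

/-! ### Flat functions and the one-sidedness of regular closed sets -/

section DefiningFunctions

variable {m : ℕ} {M : Type u} [TopologicalSpace M] [ChartedSpace (EuclideanSpace ℝ (Fin m)) M]

/-- `f`, with nonzero derivative `D` at `x`, is near `x` a defining function for a domain `A` with
interior `A'` and wall `s`. -/
structure IsDefiningFunction (A A' s : Set M) (x : M) (f : M → ℝ)
    (D : TangentSpace (𝓡 m) x →L[ℝ] ℝ) : Prop where
  hasMFDerivAt : HasMFDerivAt (𝓡 m) 𝓘(ℝ, ℝ) f x D
  ne_zero : ∃ v, D v ≠ 0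
  continuousAt : ∀ᶠ q in 𝓝 x, ContinuousAt f q
  mem_wall : ∀ᶠ q in 𝓝 x, (q ∈ s ↔ f q = 0)
  mem_iff : ∀ᶠ q in 𝓝 x, (q ∈ A ↔ 0 ≤ f q)
  mem_interior : ∀ᶠ q in 𝓝 x, (q ∈ A' ↔ 0 < f q)

/-- `f` is, in some chart, an affine function vanishing at `x`. -/
def IsFlatAt (m : ℕ) {M : Type u} [TopologicalSpace M]
    [ChartedSpace (EuclideanSpace ℝ (Fin m)) M] (f : M → ℝ) (x : M) : Prop :=
  ∃ φ ∈ IsManifold.maximalAtlas (𝓡 m) ∞ M, x ∈ φ.source ∧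
    ∃ ℓ : EuclideanSpace ℝ (Fin m) →L[ℝ] ℝ, ∀ q, f q = ℓ (φ q - φ x)

namespace IsFlatAt

variable {f : M → ℝ} {x : M}

theorem neg (h : IsFlatAt m f x) : IsFlatAt m (fun q ↦ -f q) x := by
  obtain ⟨φ, hφ, hx, ℓ, hf⟩ := h
  exact ⟨φ, hφ, hx, -ℓ, fun q ↦ by simp [hf]⟩

theorem continuousAt (h : IsFlatAt m f x) : ∀ᶠ q in 𝓝 x, ContinuousAt f q := by
  obtain ⟨φ, hφ, hx, ℓ, hf⟩ := h
  filter_upwards [φ.open_source.mem_nhds hx] with q hq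
  have := φ.continuousAt hq
  have hf' : f = fun q ↦ ℓ (φ q - φ x) := funext hf
  rw [hf']
  fun_prop

/-- The subsets of a small neighbourhood on which a flat function is positive or negative are
connected. -/
theorem exists_nhds_isPreconnected (h : IsFlatAt m f x) {N : Set M} (hN : N ∈ 𝓝 x) :
    ∃ U ∈ 𝓝 x, U ⊆ N ∧ IsPreconnected {q ∈ U | 0 < f q} ∧ IsPreconnected {q ∈ U | f q < 0} := by
  obtain ⟨φ, hφ, hx, ℓ, hf⟩ := h
  have hev : ∀ᶠ z in 𝓝 (φ x), z ∈ φ.target ∧ φ.symm z ∈ N :=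
    (φ.open_target.eventually_mem (φ.map_source hx)).and
      ((φ.tendsto_symm hx).eventually hN)
  obtain ⟨r, hr, hball⟩ := Metric.eventually_nhds_iff_ball.1 hev
  have hsub : Metric.ball (φ x) r ⊆ φ.target := fun z hz ↦ (hball z hz).1
  have hset : ∀ p : ℝ → Prop, {q ∈ φ.symm '' Metric.ball (φ x) r | p (f q)} =
      φ.symm '' {z ∈ Metric.ball (φ x) r | p (ℓ (z - φ x))} := by
    intro p
    ext q
    constructor
    · rintro ⟨⟨z, hz, rfl⟩, hp⟩
      rw [hf, φ.right_inv (hsub hz)] at hp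
      exact ⟨z, ⟨hz, hp⟩, rfl⟩
    · rintro ⟨z, ⟨hz, hp⟩, rfl⟩
      refine ⟨⟨z, hz, rfl⟩, ?_⟩
      rwa [hf, φ.right_inv (hsub hz)]
  -- In the chart, each side is a ball cut by an affine half-space, hence convex.
  have hconn : ∀ T : Set ℝ, Convex ℝ T → IsPreconnected
      {q ∈ φ.symm '' Metric.ball (φ x) r | f q ∈ T} := by
    intro T hT
    rw [hset (· ∈ T)]
    refine IsPreconnected.image ?_ _ (φ.continuousOn_symm.mono fun z hz ↦ hsub hz.1)
    have hc : Convex ℝ ({z | ℓ (z - φ x) ∈ T}) := by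
      have h1 : Convex ℝ ((fun z ↦ -φ x + z) ⁻¹' (ℓ ⁻¹' T)) :=
        (hT.linear_preimage ℓ.toLinearMap).translate_preimage_right (-φ x)
      convert h1 using 2
      ext z
      simp [sub_eq_neg_add]
    exact ((convex_ball _ _).inter hc).isPreconnected
  refine ⟨φ.symm '' Metric.ball (φ x) r, ?_, ?_, hconn _ (convex_Ioi 0), hconn _ (convex_Iio 0)⟩
  · have h1 := φ.symm.image_mem_nhds (φ.map_source hx) (Metric.ball_mem_nhds _ hr)
    rwa [φ.left_inv hx] at h1
  · rintro _ ⟨z, hz, rfl⟩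
    exact (hball z hz).2

variable [IsManifold (𝓡 m) ∞ M]

/-- Nonvanishing somewhere near x rules out a zero linear form, and then the derivative is nonzero
because dφ is onto. A vector in its kernel is realised by a straight line in the chart, along which
the affine function stays zero. -/
theorem exists_hasMFDerivAt (h : IsFlatAt m f x) (hne : ∃ᶠ q in 𝓝 x, f q ≠ 0) :
    ∃ D : TangentSpace (𝓡 m) x →L[ℝ] ℝ, HasMFDerivAt (𝓡 m) 𝓘(ℝ, ℝ) f x D ∧ (∃ v, D v ≠ 0) ∧
      ∀ v, D v = 0 → ∃ γ, IsCurveWithVelocity γ x v ∧ ∀ᶠ t in 𝓝 0, f (γ t) = 0 := by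
  obtain ⟨φ, hφ, hx, ℓ, hf⟩ := h
  have hd := mdifferentiable_of_mem_maximalAtlas hφ
  have hf' : f = (fun z ↦ ℓ (z - φ x)) ∘ φ := funext hf
  have hℓ : HasMFDerivAt (𝓡 m) 𝓘(ℝ, ℝ) (fun z ↦ ℓ (z - φ x)) (φ x) ℓ := by
    apply HasFDerivAt.hasMFDerivAt
    exact ℓ.hasFDerivAt.comp (φ x) ((hasFDerivAt_id (φ x)).sub_const (φ x))
  refine ⟨ℓ.comp (mfderiv (𝓡 m) (𝓡 m) φ x), ?_, ?_, ?_⟩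
  · rw [hf']
    exact hℓ.comp x (hd.mdifferentiableAt hx).hasMFDerivAt
  · obtain ⟨q, hq⟩ := hne.exists
    obtain ⟨v, hv⟩ := hd.mfderiv_surjective hx (φ q - φ x)
    refine ⟨v, ?_⟩
    change ℓ (mfderiv (𝓡 m) (𝓡 m) φ x v) ≠ 0
    rw [hv]
    rwa [hf] at hq
  · intro v hv
    obtain ⟨w, hw⟩ : ∃ w : EuclideanSpace ℝ (Fin m), mfderiv (𝓡 m) (𝓡 m) φ x v = w := ⟨_, rfl⟩
    refine ⟨_, isCurveWithVelocity_line hφ hx hw, ?_⟩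
    have hcont : Filter.Tendsto (fun t : ℝ ↦ φ x + t • w) (𝓝 0) (𝓝 (φ x)) := by
      have : Continuous (fun t : ℝ ↦ φ x + t • w) := by fun_prop
      simpa using this.tendsto 0
    filter_upwards [hcont.eventually (φ.open_target.mem_nhds (φ.map_source hx))] with t ht
    have hv' : ℓ (mfderiv (𝓡 m) (𝓡 m) φ x v) = 0 := hv
    rw [hw] at hv'
    rw [hf, φ.right_inv ht, add_sub_cancel_left, map_smul, hv', smul_zero]

end IsFlatAt

/-- A regular closed set whose frontier is near `x` the zero set of a flat function lies near `x`
on exactly one side of its frontier. -/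
theorem IsFlatAt.exists_side {f : M → ℝ} {x : M} (hf : IsFlatAt m f x) {F : Set M}
    (hF : F = closure (interior F)) (hx : x ∈ F \ interior F)
    (hzero : ∀ᶠ q in 𝓝 x, (q ∈ F \ interior F ↔ f q = 0)) :
    ∃ g : M → ℝ, IsFlatAt m g x ∧ ∀ᶠ q in 𝓝 x, (q ∈ F \ interior F ↔ g q = 0) ∧
      (q ∈ F ↔ 0 ≤ g q) ∧ (q ∈ interior F ↔ 0 < g q) := by
  have hcl : IsClosed F := hF ▸ isClosed_closure
  obtain ⟨U, hU, hUN, hpos, hneg⟩ := hf.exists_nhds_isPreconnected hzero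
  -- Away from the zero set, the disjoint open sets `interior F` and `Fᶜ` cover V.
  have hcases : ∀ V ⊆ U, (∀ q ∈ V, f q ≠ 0) → IsPreconnected V →
      V ⊆ interior F ∨ V ⊆ Fᶜ := by
    intro V hVU hV hc
    refine IsPreconnected.subset_or_subset isOpen_interior hcl.isOpen_compl ?_ ?_ hc
    · exact Set.disjoint_left.2 fun q hq hq' ↦ hq' (interior_subset hq)
    · intro q hq
      by_contra hcon
      simp only [Set.mem_union, Set.mem_compl_iff, not_or, not_not] at hcon
      exact hV q hq ((hUN (hVU hq)).1 ⟨hcon.2, hcon.1⟩)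
  have hside : ∀ g : M → ℝ, IsFlatAt m g x → (∀ q ∈ U, q ∈ F \ interior F ↔ g q = 0) →
      (∀ q ∈ U, 0 < g q → q ∈ interior F) → (∀ q ∈ U, g q < 0 → q ∉ F) →
      ∃ g : M → ℝ, IsFlatAt m g x ∧ ∀ᶠ q in 𝓝 x, (q ∈ F \ interior F ↔ g q = 0) ∧
      (q ∈ F ↔ 0 ≤ g q) ∧ (q ∈ interior F ↔ 0 < g q) := by
    intro g hg h0 hp hn
    refine ⟨g, hg, ?_⟩
    filter_upwards [hU] with q hq
    have h0 := h0 q hq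
    have hp := hp q hq
    have hn := hn q hq
    have hi : q ∈ interior F → q ∈ F := fun h ↦ interior_subset h
    refine ⟨h0, ?_⟩
    rcases lt_trichotomy (g q) 0 with h | h | h
    · have := hn h
      exact ⟨by simp [this, h], by simp only [not_lt.2 h.le, iff_false]; exact fun h ↦ this (hi h)⟩
    · have := h0.2 h
      exact ⟨by simp [this.1, h], by simp [this.2, h]⟩
    · have := hp h
      exact ⟨by simp [hi this, h.le], by simp [this, h]⟩
  rcases hcases _ (fun q hq ↦ hq.1) (fun q hq ↦ hq.2.ne') hpos with hp | hp <;>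
  rcases hcases _ (fun q hq ↦ hq.1) (fun q hq ↦ hq.2.ne) hneg with hn | hn
  -- Both sides inside F: then F is a neighbourhood of x, which is not an interior point.
  · exfalso
    apply hx.2
    rw [mem_interior_iff_mem_nhds]
    refine Filter.mem_of_superset hU fun q hq ↦ ?_
    rcases lt_trichotomy (f q) 0 with h | h | h
    · exact interior_subset (hn ⟨hq, h⟩)
    · exact ((hUN hq).2 h).1
    · exact interior_subset (hp ⟨hq, h⟩)
  · exact hside f hf (fun q hq ↦ hUN hq) (fun q hq h ↦ hp ⟨hq, h⟩) (fun q hq h ↦ hn ⟨hq, h⟩)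
  · refine hside _ hf.neg (fun q hq ↦ ?_) (fun q hq h ↦ hn ⟨hq, ?_⟩) (fun q hq h ↦ hp ⟨hq, ?_⟩)
    · rw [neg_eq_zero]
      exact hUN hq
    · simpa using h
    · simpa using h
  -- Both sides outside F: then `interior F` misses U, although x lies in its closure.
  · exfalso
    have hxc : x ∈ closure (interior F) := hF ▸ hx.1
    obtain ⟨q, hqU, hq⟩ := mem_closure_iff_nhds.1 hxc U hU
    rcases lt_trichotomy (f q) 0 with h | h | h
    · exact hn ⟨hqU, h⟩ (interior_subset hq)
    · exact ((hUN hqU).2 h).2 hq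
    · exact hp ⟨hqU, h⟩ (interior_subset hq)

end DefiningFunctions

/-! ### Local structure of polyhedra at interior points of facets -/

section Polyhedra

theorem Cell.subset_boundary_of_mem_faces_succ {M : Type u} {c : Cell M} {k : ℕ} {f : Set M}
    (hsub : ∀ j, ∀ g ∈ (c.facet j).faces k, g ⊆ (c.facet j).carrier) (hf : f ∈ c.faces (k + 1)) :
    f ⊆ c.boundary := by
  obtain ⟨j, hj⟩ : ∃ j, f ∈ (c.facet j).faces k := by simpa [Cell.faces] using hf
  exact (hsub j f hj).trans (Set.subset_iUnion (fun j ↦ (c.facet j).carrier) j)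

variable {m : ℕ} {M : Type u} [TopologicalSpace M] [ChartedSpace (EuclideanSpace ℝ (Fin m)) M]

/-- In full dimension the model subspace is everything, so S contains whole chart domains. Relative
interiors of top-dimensional cells are therefore ordinary interiors. -/
theorem IsSubmanifold.isOpen {S : Set M} (hS : IsSubmanifold m m S) : IsOpen S := by
  rw [isOpen_iff_mem_nhds]
  intro p hp
  obtain ⟨φ, -, hpφ, W, hW, h⟩ := hS p hp
  have hW' : W = ⊤ := Submodule.eq_top_of_finrank_eq (by simpa using hW)
  refine Filter.mem_of_superset (φ.open_source.mem_nhds hpφ) fun q hq ↦ ?_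
  rw [h q hq, hW']
  trivial

theorem relInterior_eq_interior {S F : Set M} (hS : IsOpen S) (hF : F ⊆ S) :
    relInterior S F = interior F := by
  ext x
  rw [mem_interior_iff_mem_nhds]
  constructor
  · rintro ⟨hx, h⟩
    rwa [hS.nhdsWithin_eq hx] at h
  · intro h
    exact ⟨hF (mem_of_mem_nhds h), mem_nhdsWithin_of_mem_nhds h⟩

namespace IsConnectedPolyhedron

variable {k : ℕ} {c : Cell M}

theorem isClosed [T2Space M] (hc : IsConnectedPolyhedron m k c) : IsClosed c.carrier := by
  cases k with
  | zero =>
    obtain ⟨p, hp⟩ := hc.1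
    rw [hp]
    exact isClosed_singleton
  | succ k => exact hc.1.isClosed

theorem isConnectedPolyhedron_facet (hc : IsConnectedPolyhedron m k c) (j : Fin c.numFacets) :
    ∃ l, k = l + 1 ∧ IsConnectedPolyhedron m l (c.facet j) := by
  cases k with
  | zero =>
    have := hc.2 ▸ j
    exact this.elim0
  | succ k => exact ⟨k, rfl, hc.2.2.2.1 j⟩

theorem boundary_subset (hc : IsConnectedPolyhedron m k c) : c.boundary ⊆ c.carrier := by
  cases k with
  | zero =>
    refine Set.iUnion_subset fun j ↦ ?_
    obtain ⟨l, hl, -⟩ := hc.isConnectedPolyhedron_facet j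
    omega
  | succ k =>
    obtain ⟨S, -, -, -, -, -, hb⟩ := hc.2.2.1
    rw [← hb]
    exact Set.sdiff_subset

theorem interior_nonempty (hc : IsConnectedPolyhedron m k c) : c.interior.Nonempty := by
  cases k with
  | zero =>
    obtain ⟨p, hp⟩ := hc.1
    refine ⟨p, by simp [hp], fun hmem ↦ ?_⟩
    obtain ⟨j, -⟩ := Set.mem_iUnion.1 hmem
    obtain ⟨l, hl, -⟩ := hc.isConnectedPolyhedron_facet j
    omega
  | succ k =>
    obtain ⟨S, -, -, -, ⟨p, hp⟩, hcl, hb⟩ := hc.2.2.1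
    refine ⟨p, ?_, ?_⟩
    · rw [hcl]
      exact subset_closure hp
    · rw [← hb]
      exact fun h ↦ h.2 hp

theorem subset_carrier_of_mem_faces (hc : IsConnectedPolyhedron m k c) {l : ℕ} {f : Set M}
    (hf : f ∈ c.faces l) : f ⊆ c.carrier := by
  induction l generalizing k c f with
  | zero =>
    obtain rfl : f = c.carrier := hf
    exact subset_rfl
  | succ l ih =>
    refine (Cell.subset_boundary_of_mem_faces_succ (fun j g hg ↦ ?_) hf).trans hc.boundary_subset
    obtain ⟨k', -, hk'⟩ := hc.isConnectedPolyhedron_facet j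
    exact ih hk' hg

theorem subset_boundary_of_mem_faces_succ (hc : IsConnectedPolyhedron m k c) {l : ℕ} {f : Set M}
    (hf : f ∈ c.faces (l + 1)) : f ⊆ c.boundary := by
  refine Cell.subset_boundary_of_mem_faces_succ (fun j g hg ↦ ?_) hf
  obtain ⟨k', -, hk'⟩ := hc.isConnectedPolyhedron_facet j
  exact hk'.subset_carrier_of_mem_faces hg

/-- Near an interior point, a polyhedron of codimension one is the zero set of a flat function. -/
theorem exists_isFlatAt [IsManifold (𝓡 m) ∞ M] (hc : IsConnectedPolyhedron m k c) (hk : k + 1 = m)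
    {x : M} (hx : x ∈ c.interior) :
    ∃ f : M → ℝ, IsFlatAt m f x ∧ ∀ᶠ q in 𝓝 x, (q ∈ c.carrier ↔ f q = 0) := by
  obtain ⟨φ, hφ, hxφ, W, hW, h⟩ : ∃ φ ∈ IsManifold.maximalAtlas (𝓡 m) ∞ M, x ∈ φ.source ∧
      ∃ W : Submodule ℝ (EuclideanSpace ℝ (Fin m)), Module.finrank ℝ W = k ∧
      ∀ᶠ q in 𝓝 x, (q ∈ c.carrier ↔ φ q - φ x ∈ W) := by
    cases k with
    -- Here m = 1 and the face is a point, cut out by the zero subspace in any chart.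
    | zero =>
      refine ⟨chartAt (EuclideanSpace ℝ (Fin m)) x, IsManifold.chart_mem_maximalAtlas x, mem_chart_source _ x, ⊥,
        finrank_bot _ _, ?_⟩
      obtain ⟨p, hp⟩ := hc.1
      have hxp : x = p := by simpa [hp] using hx.1
      filter_upwards [(chartAt (EuclideanSpace ℝ (Fin m)) x).open_source.mem_nhds (mem_chart_source _ x)] with q hq
      rw [hp, Set.mem_singleton_iff, ← hxp, Submodule.mem_bot, sub_eq_zero]
      exact ((chartAt (EuclideanSpace ℝ (Fin m)) x).injOn.eq_iff hq (mem_chart_source _ x)).symm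
    | succ k =>
      obtain ⟨S, hS, -, hcS, -, -, hb⟩ := hc.2.2.1
      have hxS : x ∈ relInterior S c.carrier := by
        by_contra hcon
        exact hx.2 (hb ▸ ⟨hx.1, hcon⟩)
      obtain ⟨φ, hφ, hxφ, W, hW, h⟩ := hS x hxS.1
      refine ⟨φ, hφ, hxφ, W, hW, ?_⟩
      filter_upwards [φ.open_source.mem_nhds hxφ, mem_nhdsWithin_iff_eventually.1 hxS.2]
        with q hq hq'
      rw [← h q hq]
      exact ⟨fun h ↦ hcS h, hq'⟩
  -- W has codimension one, so it is the kernel of a single linear form.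
  have hlt : W < ⊤ := by
    refine lt_top_iff_ne_top.2 fun hcon ↦ ?_
    rw [hcon, finrank_top, finrank_euclideanSpace_fin] at hW
    omega
  obtain ⟨ℓ, hℓ, hle⟩ := W.exists_le_ker_of_lt_top hlt
  have hker : W = LinearMap.ker ℓ := by
    refine Submodule.eq_of_le_of_finrank_eq hle ?_
    have h1 := Module.Dual.finrank_ker_add_one_of_ne_zero hℓ
    rw [finrank_euclideanSpace_fin] at h1
    omega
  refine ⟨fun q ↦ ℓ (φ q - φ x), ⟨φ, hφ, hxφ, LinearMap.toContinuousLinearMap ℓ, fun q ↦ rfl⟩, ?_⟩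
  filter_upwards [h] with q hq
  rw [hq, hker, LinearMap.mem_ker]

end IsConnectedPolyhedron

theorem CompactSmoothPolyhedron.exists_isConnectedPolyhedron_facet
    (P : CompactSmoothPolyhedron m m M) (s : P.Facet) :
    ∃ k, IsConnectedPolyhedron m k (P.facet s) := by
  obtain ⟨k, -, hk⟩ := (P.isConnectedPolyhedron s.1).isConnectedPolyhedron_facet s.2
  exact ⟨k, hk⟩

/-- The local structure of a polyhedron near an interior point of one of its facets. -/
theorem exists_isFlatAt_of_mem_interior_facet [T2Space M] [IsManifold (𝓡 m) ∞ M]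
    (P : CompactSmoothPolyhedron m m M) (s : P.Facet) {x : M} (hx : x ∈ (P.facet s).interior) :
    ∃ (f : M → ℝ) (D : TangentSpace (𝓡 m) x →L[ℝ] ℝ), IsFlatAt m f x ∧
      IsDefiningFunction P.carrier P.interior (P.facet s).carrier x f D ∧
      ∀ v, D v = 0 → IsTangentTo (P.facet s).carrier x v := by
  obtain ⟨i, j⟩ := s
  -- The dimension of the cell is decoupled from m to allow a case split on it.
  have key : ∀ n, n = m → IsConnectedPolyhedron m n (P.cell i) →
      ∃ f : M → ℝ, IsFlatAt m f x ∧ (∃ᶠ q in 𝓝 x, f q ≠ 0) ∧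
        ∀ᶠ q in 𝓝 x, (q ∈ ((P.cell i).facet j).carrier ↔ f q = 0) ∧
          (q ∈ (P.cell i).carrier ↔ 0 ≤ f q) ∧ (q ∈ (P.cell i).interior ↔ 0 < f q) := by
    intro n hn hc
    cases n with
    | zero =>
      obtain ⟨l, hl, -⟩ := hc.isConnectedPolyhedron_facet j
      omega
    | succ n =>
      obtain ⟨-, -, ⟨S, hS, -, hFS, -, hcl, hb⟩, hfac, hmeet⟩ := hc
      rw [hn] at hS
      rw [relInterior_eq_interior hS.isOpen hFS] at hcl hb
      have hint : (P.cell i).interior = interior (P.cell i).carrier := by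
        rw [Cell.interior, ← hb, Set.sdiff_sdiff_right_self]
        exact Set.inter_eq_right.2 interior_subset
      have hxF : x ∈ (P.cell i).carrier \ interior (P.cell i).carrier := by
        rw [hb]
        exact Set.mem_iUnion.2 ⟨j, hx.1⟩
      -- Distinct facets meet only in their boundaries, so the other facets, being closed, stay away
      -- from x.
      have hothers : ∀ᶠ q in 𝓝 x, ∀ l, l ≠ j → q ∉ ((P.cell i).facet l).carrier := by
        rw [Filter.eventually_all]
        intro l
        rw [Filter.eventually_imp_distrib_left]
        intro hlj
        refine (hfac l).isClosed.isOpen_compl.mem_nhds fun hxl ↦ ?_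
        have : x ∈ ((P.cell i).facet l).carrier ∩ ((P.cell i).facet j).carrier := ⟨hxl, hx.1⟩
        rw [(hmeet l j hlj).1] at this
        exact hx.2 this.2
      have hwall : ∀ᶠ q in 𝓝 x, (q ∈ ((P.cell i).facet j).carrier ↔
          q ∈ (P.cell i).carrier \ interior (P.cell i).carrier) := by
        filter_upwards [hothers] with q hq
        rw [hb]
        constructor
        · exact fun h ↦ Set.mem_iUnion.2 ⟨j, h⟩
        · intro h
          obtain ⟨l, hl⟩ := Set.mem_iUnion.1 h
          by_cases hlj : l = j
          · exact hlj ▸ hl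
          · exact (hq l hlj hl).elim
      obtain ⟨f₀, hf₀, hz₀⟩ := (hfac j).exists_isFlatAt hn hx
      obtain ⟨f, hf, hsides⟩ := hf₀.exists_side hcl hxF (by
        filter_upwards [hwall, hz₀] with q h1 h2
        rw [← h1, h2])
      refine ⟨f, hf, ?_, ?_⟩
      · have hxc : x ∈ closure (interior (P.cell i).carrier) := hcl ▸ hxF.1
        refine ((mem_closure_iff_frequently.1 hxc).and_eventually hsides).mono fun q hq ↦ ?_
        exact (hq.2.2.2.1 hq.1).ne'
      · filter_upwards [hwall, hsides] with q h1 h2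
        rw [hint, h1]
        exact h2
  obtain ⟨f, hf, hne, hside⟩ := key m rfl (P.isConnectedPolyhedron i)
  obtain ⟨D, hD, hD0, htan⟩ := hf.exists_hasMFDerivAt hne
  have hothers : ∀ᶠ q in 𝓝 x, ∀ l, l ≠ i → q ∉ (P.cell l).carrier := by
    rw [Filter.eventually_all]
    intro l
    rw [Filter.eventually_imp_distrib_left]
    intro hli
    refine (P.isConnectedPolyhedron l).isClosed.isOpen_compl.mem_nhds fun hxl ↦ ?_
    refine Set.disjoint_left.1 (P.disjoint l i hli) hxl ?_
    exact (P.isConnectedPolyhedron i).boundary_subset (Set.mem_iUnion.2 ⟨j, hx.1⟩)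
  refine ⟨f, D, hf, ⟨hD, hD0, hf.continuousAt, ?_, ?_, ?_⟩, ?_⟩
  · exact hside.mono fun q hq ↦ hq.1
  · filter_upwards [hside, hothers] with q h1 h2
    rw [← h1.2.1]
    constructor
    · intro h
      obtain ⟨l, hl⟩ := Set.mem_iUnion.1 h
      by_cases hli : l = i
      · exact hli ▸ hl
      · exact (h2 l hli hl).elim
    · exact fun h ↦ Set.mem_iUnion.2 ⟨i, h⟩
  · filter_upwards [hside, hothers] with q h1 h2
    rw [← h1.2.2]
    constructor
    · intro h
      obtain ⟨l, hl⟩ := Set.mem_iUnion.1 h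
      by_cases hli : l = i
      · exact hli ▸ hl
      · exact (h2 l hli hl.1).elim
    · exact fun h ↦ Set.mem_iUnion.2 ⟨i, h⟩
  · intro v hv
    obtain ⟨γ, hγ, hzero⟩ := htan v hv
    refine ⟨γ, hγ, ?_⟩
    filter_upwards [hγ.tendsto.eventually hside, hzero] with t h1 h2
    exact h1.1.2 h2

end Polyhedra

/-! ### Sign of a function just after a zero -/

section OneVariable

theorem eventually_pos_of_hasDerivAt {h : ℝ → ℝ} {d : ℝ} (hd : HasDerivAt h d 0) (h0 : h 0 = 0)
    (hpos : 0 < d) : ∀ᶠ t in 𝓝[>] 0, 0 < h t := by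
  have h1 := (hasDerivAt_iff_tendsto_slope.1 hd).eventually (lt_mem_nhds hpos)
  have h2 : 𝓝[>] (0 : ℝ) ≤ 𝓝[≠] 0 := nhdsWithin_mono _ fun t (ht : 0 < t) ↦ ht.ne'
  filter_upwards [h2 h1, self_mem_nhdsWithin] with t ht ht0
  have ht' : 0 < slope h 0 t := ht
  rw [slope_def_field, h0, sub_zero, sub_zero] at ht'
  exact (div_pos_iff_of_pos_right ht0).1 ht'

theorem nonneg_of_hasDerivAt {h : ℝ → ℝ} {d : ℝ} (hd : HasDerivAt h d 0) (h0 : h 0 = 0)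
    (hpos : ∀ᶠ t in 𝓝[>] 0, 0 < h t) : 0 ≤ d := by
  by_contra! hneg
  have h1 := eventually_pos_of_hasDerivAt hd.neg (by simp [h0]) (neg_pos.2 hneg)
  obtain ⟨t, ht, ht'⟩ := (h1.and hpos).exists
  have : 0 < -h t := ht
  linarith

end OneVariable

/-! ### Comparison of two domains with a common wall -/

section DefiningFunctions

variable {m : ℕ} {M : Type u} [TopologicalSpace M] [ChartedSpace (EuclideanSpace ℝ (Fin m)) M]
  {A A' B B' s : Set M} {x : M} {f g : M → ℝ} {D D' : TangentSpace (𝓡 m) x →L[ℝ] ℝ}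

namespace IsDefiningFunction

theorem apply_self (h : IsDefiningFunction A A' s x f D) (hx : x ∈ s) : f x = 0 :=
  h.mem_wall.self_of_nhds.1 hx

theorem eq_zero_of_isTangentTo (h : IsDefiningFunction A A' s x f D) {v : TangentSpace (𝓡 m) x}
    (hv : IsTangentTo s x v) : D v = 0 := by
  obtain ⟨γ, hγ, hs⟩ := hv
  have h1 : (fun t ↦ f (γ t)) =ᶠ[𝓝 0] fun _ ↦ 0 := by
    filter_upwards [hs, hγ.tendsto.eventually h.mem_wall] with t h1 h2
    exact h2.1 h1
  exact (hγ.hasDerivAt_comp h.hasMFDerivAt).unique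
    ((hasDerivAt_const (0 : ℝ) (0 : ℝ)).congr_of_eventuallyEq h1)

theorem nonneg_of_pointsToward (h : IsDefiningFunction A A' s x f D) (hx : x ∈ s)
    {v : TangentSpace (𝓡 m) x} (hv : PointsToward A' x v) : 0 ≤ D v := by
  obtain ⟨γ, hγ, hs⟩ := hv
  refine nonneg_of_hasDerivAt (hγ.hasDerivAt_comp h.hasMFDerivAt)
    (by rw [hγ.1, h.apply_self hx]) ?_
  filter_upwards [hs, (hγ.tendsto.mono_left nhdsWithin_le_nhds).eventually h.mem_interior]
    with t h1 h2
  exact h2.1 h1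

theorem pointsToward_of_pos [IsManifold (𝓡 m) ∞ M] (h : IsDefiningFunction A A' s x f D)
    (hx : x ∈ s) {v : TangentSpace (𝓡 m) x} (hv : 0 < D v) : PointsToward A' x v := by
  obtain ⟨γ, hγ⟩ := exists_isCurveWithVelocity x v
  refine ⟨γ, hγ, ?_⟩
  have h1 := eventually_pos_of_hasDerivAt (hγ.hasDerivAt_comp h.hasMFDerivAt)
    (by rw [hγ.1, h.apply_self hx]) hv
  filter_upwards [h1, (hγ.tendsto.mono_left nhdsWithin_le_nhds).eventually h.mem_interior]
    with t h1 h2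
  exact h2.2 h1

/-- Defining functions of domains with the same wall have proportional derivatives. -/
theorem exists_eq_mul (h : IsDefiningFunction A A' s x f D)
    (htan : ∀ v, D v = 0 → IsTangentTo s x v) (h' : IsDefiningFunction B B' s x g D') :
    ∃ c ≠ 0, ∀ v, D' v = c * D v := by
  obtain ⟨v₀, hv₀⟩ := h.ne_zero
  -- Removing the v₀-component puts v in the kernel of D; such vectors are tangent to the wall, so
  -- D' kills them.
  have hmul : ∀ v, D' v = D' v₀ / D v₀ * D v := by
    intro v
    have h1 : D (v - (D v / D v₀) • v₀) = 0 := by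
      rw [map_sub, map_smul, smul_eq_mul]
      field_simp
      ring
    have h2 := h'.eq_zero_of_isTangentTo (htan _ h1)
    rw [map_sub, map_smul, smul_eq_mul] at h2
    field_simp
    field_simp at h2
    linarith
  refine ⟨_, fun hc ↦ ?_, hmul⟩
  obtain ⟨v₁, hv₁⟩ := h'.ne_zero
  exact hv₁ (by rw [hmul, hc, zero_mul])

variable [IsManifold (𝓡 m) ∞ M]

/-- A function without zeros on the connected side `0 < f` of a wall is negative there if its
derivative in some direction toward that side is negative. -/
theorem neg_of_isPreconnected {h : M → ℝ} {E : TangentSpace (𝓡 m) x →L[ℝ] ℝ}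
    (hh : HasMFDerivAt (𝓡 m) 𝓘(ℝ, ℝ) h x E) (hh0 : h x = 0)
    (hf : HasMFDerivAt (𝓡 m) 𝓘(ℝ, ℝ) f x D) (hf0 : f x = 0) {U : Set M} (hU : U ∈ 𝓝 x)
    (hc : IsPreconnected {q ∈ U | 0 < f q}) (hcont : ContinuousOn h {q ∈ U | 0 < f q})
    (hne : ∀ q ∈ U, 0 < f q → h q ≠ 0) {v : TangentSpace (𝓡 m) x} (hv : 0 < D v)
    (hEv : E v < 0) : ∀ q ∈ U, 0 < f q → h q < 0 := by
  obtain ⟨γ, hγ⟩ := exists_isCurveWithVelocity x v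
  have h1 := eventually_pos_of_hasDerivAt (hγ.hasDerivAt_comp hf) (by rw [hγ.1, hf0]) hv
  have h2 := eventually_pos_of_hasDerivAt (hγ.hasDerivAt_comp hh).neg (by simp [hγ.1, hh0])
    (neg_pos.2 hEv)
  have h3 := (hγ.tendsto.mono_left (nhdsWithin_le_nhds (s := Set.Ioi 0))).eventually hU
  obtain ⟨t, ⟨ht1, ht2⟩, ht3⟩ := ((h1.and h2).and h3).exists
  have ht2 : 0 < -h (γ t) := ht2
  intro q hq hfq
  by_contra! hcon
  obtain ⟨p, hp, hp0⟩ := hc.intermediate_value (a := γ t) (b := q) ⟨ht3, ht1⟩ ⟨hq, hfq⟩ hcont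
    (show (0 : ℝ) ∈ Set.Icc _ _ from ⟨by linarith, hcon⟩)
  exact hne p hp.1 hp.2 hp0

/-- Two domains with the same wall tessellate if and only if the derivatives of their defining
functions have opposite signs. -/
theorem exists_tessellate_iff (h : IsDefiningFunction A A' s x f D) (hx : x ∈ s)
    (hflat : IsFlatAt m f x) (h' : IsDefiningFunction B B' s x g D') {c : ℝ} (hc : c ≠ 0)
    (hD : ∀ v, D' v = c * D v) : (∃ N ∈ 𝓝 x, Tessellate A B s N) ↔ c < 0 := by
  have hpos : ∃ v, 0 < D v := by
    obtain ⟨v, hv⟩ := h.ne_zero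
    rcases hv.lt_or_gt with hv | hv
    · exact ⟨-v, by simpa using hv⟩
    · exact ⟨v, hv⟩
  obtain ⟨v, hv⟩ := hpos
  constructor
  · rintro ⟨N, hN, hcover, -⟩
    by_contra! hcon
    have hcpos : 0 < c := lt_of_le_of_ne hcon hc.symm
    -- Along this curve f and g both become negative, so it enters a region of N covered by neither
    -- domain.
    obtain ⟨γ, hγ⟩ := exists_isCurveWithVelocity x (-v)
    have hle := hγ.tendsto.mono_left (nhdsWithin_le_nhds (s := Set.Ioi 0))
    have h1 := eventually_pos_of_hasDerivAt (hγ.hasDerivAt_comp h.hasMFDerivAt).neg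
      (by simp [hγ.1, h.apply_self hx]) (by simpa using hv)
    have h2 := eventually_pos_of_hasDerivAt (hγ.hasDerivAt_comp h'.hasMFDerivAt).neg
      (by simp [hγ.1, h'.apply_self hx]) (by rw [hD]; simpa using mul_pos hcpos hv)
    obtain ⟨t, ⟨⟨⟨ht1, ht2⟩, ht3⟩, ht4⟩, ht5⟩ := ((((h1.and h2).and (hle.eventually hN)).and
      (hle.eventually h.mem_iff)).and (hle.eventually h'.mem_iff)).exists
    have ht1 : 0 < -f (γ t) := ht1
    have ht2 : 0 < -g (γ t) := ht2
    have ht3 : γ t ∈ N := ht3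
    rw [hcover] at ht3
    rcases ht3 with ht3 | ht3
    · linarith [ht4.1 ht3.2]
    · linarith [ht5.1 ht3.2]
  · intro hneg
    have hev := (((h.mem_wall.and h.mem_iff).and (h'.mem_wall.and h'.mem_iff)).and
      h'.continuousAt)
    obtain ⟨U, hU, hUN, hcp, hcn⟩ := hflat.exists_nhds_isPreconnected hev
    have hne : ∀ q ∈ U, f q ≠ 0 → g q ≠ 0 := by
      intro q hq hfq hgq
      obtain ⟨⟨⟨h1, -⟩, ⟨h2, -⟩⟩, -⟩ := hUN hq
      exact hfq (h1.1 (h2.2 hgq))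
    have hcontU : ∀ V ⊆ U, ContinuousOn g V := fun V hV q hq ↦
      (hUN (hV hq)).2.continuousWithinAt
    have hside1 : ∀ q ∈ U, 0 < f q → g q < 0 := by
      refine neg_of_isPreconnected h'.hasMFDerivAt (h'.apply_self hx) h.hasMFDerivAt
        (h.apply_self hx) hU hcp (hcontU _ fun q hq ↦ hq.1) (fun q hq hfq ↦ hne q hq hfq.ne')
        hv ?_
      rw [hD]
      exact mul_neg_of_neg_of_pos hneg hv
    have hnegd : ∀ {k : M → ℝ} {E : TangentSpace (𝓡 m) x →L[ℝ] ℝ},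
        HasMFDerivAt (𝓡 m) 𝓘(ℝ, ℝ) k x E → HasMFDerivAt (𝓡 m) 𝓘(ℝ, ℝ) (fun q ↦ -k q) x (-E) :=
      fun hk ↦ hk.neg
    have hset : {q ∈ U | 0 < -f q} = {q ∈ U | f q < 0} := by simp
    -- The other side follows by applying the same argument to -f, -g and the direction -v.
    have hside2 : ∀ q ∈ U, 0 < -f q → -g q < 0 := by
      refine neg_of_isPreconnected (hnegd h'.hasMFDerivAt) (by simp [h'.apply_self hx])
        (hnegd h.hasMFDerivAt) (by simp [h.apply_self hx]) hU (hset ▸ hcn)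
        (hcontU _ fun q hq ↦ hq.1).neg (fun q hq hfq ↦ neg_ne_zero.2 (hne q hq ?_))
        (v := -v) (by simpa using hv) ?_
      · exact (neg_pos.1 hfq).ne
      · simpa [hD] using mul_neg_of_neg_of_pos hneg hv
    refine ⟨U, hU, ?_, ?_⟩
    · rw [← Set.inter_union_distrib_left]
      refine (Set.inter_eq_left.2 fun q hq ↦ ?_).symm
      obtain ⟨⟨⟨h1, h2⟩, ⟨h3, h4⟩⟩, -⟩ := hUN hq
      rcases le_or_gt 0 (f q) with hfq | hfq
      · exact Or.inl (h2.2 hfq)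
      · exact Or.inr (h4.2 (by linarith [hside2 q hq (neg_pos.2 hfq)]))
    · ext q
      constructor
      · rintro ⟨⟨hq, hqA⟩, -, hqB⟩
        obtain ⟨⟨⟨h1, h2⟩, ⟨h3, h4⟩⟩, -⟩ := hUN hq
        refine ⟨hq, h1.2 (le_antisymm ?_ (h2.1 hqA))⟩
        by_contra! hcon
        linarith [h4.1 hqB, hside1 q hq hcon]
      · rintro ⟨hq, hqs⟩
        obtain ⟨⟨⟨h1, h2⟩, ⟨h3, h4⟩⟩, -⟩ := hUN hq
        exact ⟨⟨hq, h2.2 (h1.1 hqs).ge⟩, hq, h4.2 (h3.1 hqs).ge⟩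

end IsDefiningFunction

end DefiningFunctions

/-! ### Unit normals -/

section Normals

variable {m : ℕ} {M : Type u} [TopologicalSpace M] [ChartedSpace (EuclideanSpace ℝ (Fin m)) M]
  [Bundle.RiemannianBundle (fun x : M ↦ TangentSpace (𝓡 m) x)]

/-- The normal is the Riesz representative (gradient) of D for the riemannian inner product,
normalised. -/
theorem exists_unit_normal {x : M} (D : TangentSpace (𝓡 m) x →L[ℝ] ℝ) (hD : ∃ v, D v ≠ 0) :
    ∃ n : TangentSpace (𝓡 m) x, ‖n‖ = 1 ∧ (∀ v, D v = 0 → inner ℝ n v = 0) ∧ 0 < D n := by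
  have : FiniteDimensional ℝ (TangentSpace (𝓡 m) x) :=
    inferInstanceAs (FiniteDimensional ℝ (EuclideanSpace ℝ (Fin m)))
  have : CompleteSpace (TangentSpace (𝓡 m) x) := FiniteDimensional.complete ℝ _
  set w := (InnerProductSpace.toDual ℝ (TangentSpace (𝓡 m) x)).symm D with hw
  have hwD : ∀ v, inner ℝ w v = D v := fun v ↦ InnerProductSpace.toDual_symm_apply
  have hw0 : w ≠ 0 := by
    rintro h0
    obtain ⟨v, hv⟩ := hD
    rw [← hwD, h0, inner_zero_left] at hv
    exact hv rfl
  have hnorm : 0 < ‖w‖ := norm_pos_iff.2 hw0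
  refine ⟨‖w‖⁻¹ • w, ?_, fun v hv ↦ ?_, ?_⟩
  · rw [norm_smul, norm_inv, norm_norm, inv_mul_cancel₀ hnorm.ne']
  · rw [real_inner_smul_left, hwD, hv, mul_zero]
  · rw [map_smul, smul_eq_mul, ← hwD, real_inner_self_eq_norm_sq]
    positivity

/-- Pointing inward only gives D n ≥ 0. Equality would make n tangent to the face, hence orthogonal
to itself, against ‖n‖ = 1. -/
theorem IsInwardNormal.pos {P : CompactSmoothPolyhedron m m M} {s : P.Facet} {x : M}
    {n : TangentSpace (𝓡 m) x} (hn : IsInwardNormal P s x n) {f : M → ℝ}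
    {D : TangentSpace (𝓡 m) x →L[ℝ] ℝ}
    (h : IsDefiningFunction P.carrier P.interior (P.facet s).carrier x f D)
    (hx : x ∈ (P.facet s).carrier) (htan : ∀ v, D v = 0 → IsTangentTo (P.facet s).carrier x v) :
    0 < D n := by
  refine lt_of_le_of_ne (h.nonneg_of_pointsToward hx hn.inward) fun h0 ↦ ?_
  have h1 := hn.normal n (htan n h0.symm)
  rw [real_inner_self_eq_norm_sq, hn.norm_eq_one] at h1
  norm_num at h1

end Normals

/-! ### Transport by face-pairing isometries -/

section FacePairings

variable {m : ℕ} {M : Type u} [TopologicalSpace M] [ChartedSpace (EuclideanSpace ℝ (Fin m)) M]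
  [IsManifold (𝓡 m) ∞ M] [Bundle.RiemannianBundle (fun x : M ↦ TangentSpace (𝓡 m) x)]

theorem ComponentIsometry.mdifferentiable (g : ComponentIsometry m M) :
    g.toHomeo.MDifferentiable (𝓡 m) (𝓡 m) :=
  ⟨g.contMDiffOn.mdifferentiableOn (by simp), g.contMDiffOn_symm.mdifferentiableOn (by simp)⟩

theorem ComponentIsometry.norm_mfderiv (g : ComponentIsometry m M) {x : M}
    (hx : x ∈ g.toHomeo.source) (v : TangentSpace (𝓡 m) x) :
    ‖mfderiv (𝓡 m) (𝓡 m) g.toHomeo x v‖ = ‖v‖ := by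
  rw [@norm_eq_sqrt_real_inner, g.inner_mfderiv x hx, ← @norm_eq_sqrt_real_inner]

namespace FacePairing

variable {P : CompactSmoothPolyhedron m m M} (Φ : FacePairing P) (s : P.Facet)

/-- As I_s̄ inverts I_s, membership in an image under I_s̄ becomes a condition on I_s q. -/
theorem mem_image_iso_bar {q : M} (hq : q ∈ (Φ.iso s).toHomeo.source) (A : Set M) :
    q ∈ (Φ.iso (Φ.bar s)).image A ↔ (Φ.iso s).toHomeo q ∈ A := by
  obtain ⟨hsrc, heq⟩ := Φ.iso_bar s
  rw [OpenPartialHomeomorph.symm_source] at hsrc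
  constructor
  · rintro ⟨p, ⟨hpA, hp⟩, rfl⟩
    rw [heq hp, (Φ.iso s).toHomeo.right_inv (hsrc ▸ hp)]
    exact hpA
  · intro h
    have hmem : (Φ.iso s).toHomeo q ∈ (Φ.iso (Φ.bar s)).toHomeo.source := by
      rw [hsrc]
      exact (Φ.iso s).toHomeo.map_source hq
    refine ⟨(Φ.iso s).toHomeo q, ⟨h, hmem⟩, ?_⟩
    rw [heq hmem, (Φ.iso s).toHomeo.left_inv hq]

theorem mem_facet_iff {q : M} (hq : q ∈ (Φ.iso s).toHomeo.source) :
    q ∈ (P.facet s).carrier ↔ (Φ.iso s).toHomeo q ∈ (P.facet (Φ.bar s)).carrier := by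
  rw [← Φ.mem_image_iso_bar s hq, Φ.image_carrier, Φ.bar_bar]

/-- The face-pairing isometries map the interior of a facet to the interior of a facet. -/
theorem iso_mem_interior {x : M} (hx : x ∈ (P.facet s).interior) :
    (Φ.iso s).toHomeo x ∈ (P.facet (Φ.bar s)).interior := by
  have hxs := Φ.carrier_subset s hx.1
  refine ⟨(Φ.mem_facet_iff s hxs).1 hx.1, fun hmem ↦ hx.2 ?_⟩
  obtain ⟨k, hk⟩ := P.exists_isConnectedPolyhedron_facet s
  obtain ⟨k', hk'⟩ := P.exists_isConnectedPolyhedron_facet (Φ.bar s)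
  obtain ⟨j, hj⟩ := Set.mem_iUnion.1 hmem
  have hface : ((P.facet (Φ.bar s)).facet j).carrier ∈ (P.facet (Φ.bar s)).faces 1 :=
    Set.mem_iUnion.2 ⟨j, rfl⟩
  obtain ⟨l, hl⟩ := Φ.image_face (Φ.bar s) 1 _ hface
  rw [Φ.bar_bar] at hl
  -- A face-pairing need not preserve codimension by definition, so l = 0 must be excluded: a proper
  -- face of s̄ mapped onto all of s would be all of s̄, which has an interior point.
  cases l with
  | zero =>
    exfalso
    obtain ⟨p, hp⟩ := hk'.interior_nonempty
    have himg : (Φ.iso (Φ.bar s)).image ((P.facet (Φ.bar s)).facet j).carrier =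
      (P.facet s).carrier := hl
    have htarget : p ∈ (Φ.iso s).toHomeo.target := by
      have h1 := (Φ.iso_bar s).1
      rw [OpenPartialHomeomorph.symm_source] at h1
      rw [← h1]
      exact Φ.carrier_subset _ hp.1
    have hq := (Φ.iso s).toHomeo.map_target htarget
    have hr := (Φ.iso s).toHomeo.right_inv htarget
    have hqs : (Φ.iso s).toHomeo.symm p ∈ (P.facet s).carrier := by
      rw [Φ.mem_facet_iff s hq, hr]
      exact hp.1
    rw [← himg, Φ.mem_image_iso_bar s hq, hr] at hqs
    exact hp.2 (Set.mem_iUnion.2 ⟨j, hqs⟩)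
  | succ l =>
    exact hk.subset_boundary_of_mem_faces_succ hl ((Φ.mem_image_iso_bar s hxs _).2 hj)

/-- A defining function of `P` at a point of the facet `s̄` gives one of `I_{s̄} P` at a point of
the facet `s`. -/
theorem isDefiningFunction_comp {x : M} (hx : x ∈ (P.facet s).carrier) {A A' : Set M} {f : M → ℝ}
    {D : TangentSpace (𝓡 m) ((Φ.iso s).toHomeo x) →L[ℝ] ℝ}
    (h : IsDefiningFunction A A' (P.facet (Φ.bar s)).carrier ((Φ.iso s).toHomeo x) f D) :
    IsDefiningFunction ((Φ.iso (Φ.bar s)).image A) ((Φ.iso (Φ.bar s)).image A')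
      (P.facet s).carrier x (f ∘ (Φ.iso s).toHomeo)
      (D.comp (mfderiv (𝓡 m) (𝓡 m) (Φ.iso s).toHomeo x)) := by
  have hxs := Φ.carrier_subset s hx
  have hnhds := (Φ.iso s).toHomeo.open_source.mem_nhds hxs
  have htend := (Φ.iso s).toHomeo.continuousAt hxs
  refine ⟨h.hasMFDerivAt.comp x ((Φ.iso s).mdifferentiable.mdifferentiableAt hxs).hasMFDerivAt,
    ?_, ?_, ?_, ?_, ?_⟩
  · obtain ⟨w, hw⟩ := h.ne_zero
    obtain ⟨v, rfl⟩ := (Φ.iso s).mdifferentiable.mfderiv_surjective hxs w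
    exact ⟨v, hw⟩
  · filter_upwards [hnhds, htend.eventually h.continuousAt] with q hq hf
    exact hf.comp ((Φ.iso s).toHomeo.continuousAt hq)
  · filter_upwards [hnhds, htend.eventually h.mem_wall] with q hq hf
    rw [Φ.mem_facet_iff s hq, hf, Function.comp_apply]
  · filter_upwards [hnhds, htend.eventually h.mem_iff] with q hq hf
    rw [Φ.mem_image_iso_bar s hq, hf, Function.comp_apply]
  · filter_upwards [hnhds, htend.eventually h.mem_interior] with q hq hf
    rw [Φ.mem_image_iso_bar s hq, hf, Function.comp_apply]

/-- The local form of the equivalence, at an interior point of a facet. -/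
theorem exists_normals_iff_exists_tessellate [T2Space M] {x : M}
    (hx : x ∈ (P.facet s).interior) :
    (∃ (n : TangentSpace (𝓡 m) x) (n' : TangentSpace (𝓡 m) ((Φ.iso s).toHomeo x)),
      IsInwardNormal P s x n ∧ IsInwardNormal P (Φ.bar s) ((Φ.iso s).toHomeo x) n' ∧
      mfderiv (𝓡 m) (𝓡 m) (Φ.iso s).toHomeo x n = -n') ↔
    ∃ B ∈ 𝓝 x,
      Tessellate P.carrier ((Φ.iso (Φ.bar s)).image P.carrier) (P.facet s).carrier B := by
  have hxs := Φ.carrier_subset s hx.1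
  have hy := Φ.iso_mem_interior s hx
  obtain ⟨f, D, hflat, hf, htan⟩ := exists_isFlatAt_of_mem_interior_facet P s hx
  obtain ⟨f', D', -, hf', htan'⟩ := exists_isFlatAt_of_mem_interior_facet P (Φ.bar s) hy
  have hg := Φ.isDefiningFunction_comp s hx.1 hf'
  obtain ⟨c, hc, hcD⟩ := hf.exists_eq_mul htan hg
  have hcD' : ∀ v, D' (mfderiv (𝓡 m) (𝓡 m) (Φ.iso s).toHomeo x v) = c * D v := hcD
  rw [hf.exists_tessellate_iff hx.1 hflat hg hc hcD]
  constructor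
  · rintro ⟨n, n', hn, hn', hnn⟩
    have h1 := hn.pos hf hx.1 htan
    have h2 := hn'.pos hf' hy.1 htan'
    have h3 := hcD' n
    rw [hnn, map_neg] at h3
    by_contra! hcon
    have := mul_nonneg hcon h1.le
    linarith
  · intro hneg
    obtain ⟨n, hn1, hnD, hnpos⟩ := exists_unit_normal D hf.ne_zero
    -- The second normal is forced by the required equation; it is a unit normal because dI_s is
    -- isometric and matches the kernels of D and D', and inward because D' takes the value -c D n >
    -- 0 on it.
    refine ⟨n, -(mfderiv (𝓡 m) (𝓡 m) (Φ.iso s).toHomeo x n), ⟨hn1, fun v hv ↦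
      hnD v (hf.eq_zero_of_isTangentTo hv), hf.pointsToward_of_pos hx.1 hnpos⟩,
      ⟨?_, fun v hv ↦ ?_, ?_⟩, (neg_neg _).symm⟩
    · rw [norm_neg, (Φ.iso s).norm_mfderiv hxs, hn1]
    · obtain ⟨w, rfl⟩ := (Φ.iso s).mdifferentiable.mfderiv_surjective hxs v
      have h1 := hf'.eq_zero_of_isTangentTo hv
      rw [hcD'] at h1
      rw [inner_neg_left, (Φ.iso s).inner_mfderiv x hxs,
        hnD w ((mul_eq_zero.1 h1).resolve_left hc), neg_zero]
    · refine hf'.pointsToward_of_pos hy.1 ?_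
      rw [map_neg, hcD']
      exact neg_pos.2 (mul_neg_of_neg_of_pos hneg hnpos)

end FacePairing

end FacePairings

end SmoothPoly

open SmoothPoly in
theorem lemma3p10 {d : ℕ} {M : Type*} [EMetricSpace M]
    [ChartedSpace (EuclideanSpace ℝ (Fin d)) M] [IsManifold (𝓡 d) ∞ M]
    [Bundle.RiemannianBundle (fun x : M ↦ TangentSpace (𝓡 d) x)]
    [IsContMDiffRiemannianBundle (𝓡 d) ∞ (EuclideanSpace ℝ (Fin d))
      (fun x : M ↦ TangentSpace (𝓡 d) x)]
    [IsRiemannianManifold (𝓡 d) M]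
    (P : CompactSmoothPolyhedron d d M) (Φ : FacePairing P) :
    Φ.InteriorIntoExterior ↔
      ∀ s : P.Facet, ∀ x ∈ (P.facet s).interior, ∃ B ∈ 𝓝 x,
        Tessellate P.carrier ((Φ.iso (Φ.bar s)).image P.carrier) (P.facet s).carrier B :=
  forall_congr' fun s ↦ forall₂_congr fun _ hx ↦ Φ.exists_normals_iff_exists_tessellate s hx
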